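/- Let $W=(W_{ij})\in\mathbb R^{n\times n}$ be a row-stochastic, irreducible and aperiodic weight matrix over $n$ nodes, and let $\pi$ be its stationary distribution, i.e. the probability vector with $\pi W=\pi$. For each node $j$ let $P_{j,0}$ and $P_{j,1}$ be mutually absolutely continuous probability measures on a measurable space $\mathcal X_j$, with log-likelihood ratio $L_j=\log\frac{dP_{j,1}}{dP_{j,0}}$, such that $\mathsf E_{P_{j,1}}[e^{sL_j}]<\infty$ for every $s\le 0$. Under hypothesis $\mathcal H_\theta$, $\theta\in\{0,1\}$, node $j$ observes $X_j^{(t)}\sim P_{j,\theta}$ in round $t=1,2,\dots$, and all observations are independent over rounds and nodes; write $P_\theta\{\cdot\}$ for probabilities under $\mathcal H_\theta$. Given geometric weights $r=(r_1,\dots,r_n)$, the log-belief ratios of the nodes are defined by $$\ell_i^{(0)}=0,\qquad \ell_i^{(t)}=\sum_{j=1}^n W_{ij}\,\mu_j^{(t)},\qquad \mu_j^{(t)}=r_jL_j\big(X_j^{(t)}\big)+\ell_j^{(t-1)}\qquad(t\ge 1).$$ The log-belief ratio test of node $i$ at time $t$ with threshold $\gamma\in\mathbb R$ and randomization $\eta\in[0,1]$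 declares $\mathcal H_1$ if $\ell_i^{(t)}>\gamma$, declares $\mathcal H_1$ with probability $\eta$ if $\ell_i^{(t)}=\gamma$, and declares $\mathcal H_0$ otherwise. Its type-I and type-II errors are $$\alpha_i^{(t)}(r;\eta,\gamma)=P_0\{\ell_i^{(t)}>\gamma\}+\eta P_0\{\ell_i^{(t)}=\gamma\},\qquad \beta_i^{(t)}(r;\eta,\gamma)=P_1\{\ell_i^{(t)}<\gamma\}+(1-\eta)P_1\{\ell_i^{(t)}=\gamma\}.$$ Let $\beta_i^{(t)*}(r,\epsilon)$ be the infimum of $\beta_i^{(t)}(r;\eta,\gamma)$ over all $\eta\in[0,1]$, $\gamma\in\mathbb R$ with $\alpha_i^{(t)}(r;\eta,\gamma)\le\epsilon$. Let $\beta_{\mathrm{cen}}^{(t)*}(\epsilon)$ be the infimum of the type-II error over all randomized tests of type-I error at most $\epsilon$ that are based on the observations of all nodes in rounds $1,\dots,t$. Then for every $c>0$ and every $\epsilon\in(0,1)$, with the weights $r_j=c/\pi_j$, all divergences $D_{\mathrm{KL}}(P_{j,0}\Vert P_{j,1})$ are finite, $\beta_i^{(t)*}(r,\epsilon)$ and $\beta_{\mathrm{cen}}^{(t)*}(\epsilon)$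 are positive for all nodes $i$ and all $t\ge 0$, and for every node $i$ $$\lim_{t\to\infty}-\frac1t\log\beta_i^{(t)*}(r,\epsilon)=\sum_{j=1}^n D_{\mathrm{KL}}(P_{j,0}\Vert P_{j,1})=\lim_{t\to\infty}-\frac1t\log\beta_{\mathrm{cen}}^{(t)*}(\epsilon).$$ -/

import Mathlib

open MeasureTheory ProbabilityTheory Filter Topology

noncomputable section

namespace DecentralizedDetection

/-- A nonnegative matrix is aperiodic if, for every state `i`, the greatest common divisor of the
return times `{k ≥ 1 : (W ^ k) i i > 0}` is one. -/
def IsAperiodic {n : ℕ} (W : Matrix (Fin n) (Fin n) ℝ) : Prop :=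
  ∀ i, ∀ d : ℕ, (∀ k : ℕ, 0 < k → 0 < (W ^ k) i i → d ∣ k) → d = 1

/-- `π` is a stationary distribution of `W`: a probability vector with `π W = π`. -/
def IsStationary {n : ℕ} (W : Matrix (Fin n) (Fin n) ℝ) (π : Fin n → ℝ) : Prop :=
  π ∈ stdSimplex ℝ (Fin n) ∧ Matrix.vecMul π W = π

/-- The intermediate log-belief ratio of node `j`, formed from its fresh sample `x` and its
previous log-belief ratio `l`: `μ_j = r_j log (P_{j,1}(x) / P_{j,0}(x)) + l`. -/
def localLogBelief {n : ℕ} {𝒳 : Fin n → Type*} [∀ j, MeasurableSpace (𝒳 j)]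
    (P : Fin 2 → ∀ j, Measure (𝒳 j)) (r : Fin n → ℝ) (j : Fin n) (x : 𝒳 j) (l : ℝ) : ℝ :=
  r j * llr (P 1 j) (P 0 j) x + l

/-- The log-belief ratio `ℓ_i^{(t)}` of node `i` after `t` rounds: `ℓ_i^{(0)} = 0` and
`ℓ_i^{(t)} = ∑ j, W i j * μ_j^{(t)}`. The sample of node `j` in round `t + 1` is `x t j`. -/
def logBelief {n : ℕ} {𝒳 : Fin n → Type*} [∀ j, MeasurableSpace (𝒳 j)]
    (W : Matrix (Fin n) (Fin n) ℝ) (P : Fin 2 → ∀ j, Measure (𝒳 j)) (r : Fin n → ℝ)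
    (x : ℕ → ∀ j, 𝒳 j) : ℕ → Fin n → ℝ
  | 0, _ => 0
  | t + 1, i => ∑ j, W i j * localLogBelief P r j (x t j) (logBelief W P r x t j)

/-- Type-I error of the test that declares hypothesis `1` if `S > γ`, declares it with probability
`η` if `S = γ`, and declares hypothesis `0` otherwise. -/
def typeIError {Ω : Type*} [MeasurableSpace Ω] (Pr : Fin 2 → Measure Ω) (S : Ω → ℝ)
    (η γ : ℝ) : ℝ :=
  (Pr 0).real {ω | γ < S ω} + η * (Pr 0).real {ω | S ω = γ}

/-- Type-II error of the same test. -/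
def typeIIError {Ω : Type*} [MeasurableSpace Ω] (Pr : Fin 2 → Measure Ω) (S : Ω → ℝ)
    (η γ : ℝ) : ℝ :=
  (Pr 1).real {ω | S ω < γ} + (1 - η) * (Pr 1).real {ω | S ω = γ}

/-- The optimal type-II error `β_i^{(t)*}(r, ε)` of the log-belief ratio test of node `i` after
`t` rounds, over all randomizations `η` and thresholds `γ` with type-I error at most `ε`. -/
def optTypeII {n : ℕ} {𝒳 : Fin n → Type*} [∀ j, MeasurableSpace (𝒳 j)]
    {Ω : Type*} [MeasurableSpace Ω] (W : Matrix (Fin n) (Fin n) ℝ)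
    (P : Fin 2 → ∀ j, Measure (𝒳 j)) (Pr : Fin 2 → Measure Ω) (X : ℕ → ∀ j, Ω → 𝒳 j)
    (r : Fin n → ℝ) (ε : ℝ) (i : Fin n) (t : ℕ) : ℝ :=
  sInf {b | ∃ η ∈ Set.Icc (0 : ℝ) 1, ∃ γ : ℝ,
    typeIError Pr (fun ω => logBelief W P r (fun τ j => X τ j ω) t i) η γ ≤ ε ∧
    b = typeIIError Pr (fun ω => logBelief W P r (fun τ j => X τ j ω) t i) η γ}

/-- The optimal type-II error of the centralized problem after `t` rounds: the infimum over all
randomized tests `φ` (the probability of declaring hypothesis `1`) that see the samples of all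
nodes in the first `t` rounds and have type-I error at most `ε`. -/
def optTypeIICentralized {n : ℕ} {𝒳 : Fin n → Type*} [∀ j, MeasurableSpace (𝒳 j)]
    {Ω : Type*} [MeasurableSpace Ω] (Pr : Fin 2 → Measure Ω) (X : ℕ → ∀ j, Ω → 𝒳 j)
    (ε : ℝ) (t : ℕ) : ℝ :=
  sInf {b | ∃ φ : (Fin t → ∀ j, 𝒳 j) → ℝ, Measurable φ ∧ (∀ x, φ x ∈ Set.Icc (0 : ℝ) 1) ∧
    ∫ ω, φ (fun τ j => X τ j ω) ∂(Pr 0) ≤ ε ∧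
    b = ∫ ω, (1 - φ (fun τ j => X τ j ω)) ∂(Pr 1)}

end DecentralizedDetection

end

/-!
The optimal type-II errors decay at the rate `D = ∑ j, D_j`, `D_j = KL(P_{j,0} ‖ P_{j,1})`, because
they are trapped between `exp (-t (D + δ))` and `exp (-t (D - δ))` for every `δ > 0`.

Lower bound, for every test. Let `S_t` be the total log-likelihood ratio of the first `t` rounds.
Writing the type-II error of a test as an expectation under hypothesis `0` of the likelihood ratio
`exp S_t` and discarding the event `{S_t < -A}` shows that it is at least
`exp (-A) * (1 - ε - P_0 {S_t < -A})` (`exp_neg_mul_le_integral_one_sub`). By Chebyshev's inequality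
`S_t` concentrates at `-t D` under hypothesis `0`, so `A = t (D + δ)` gives the converse, while a
large `A` gives positivity. The log-belief test is a particular centralized test
(`optTypeIICentralized_le_optTypeII`), so the same bounds hold for it.

Upper bound, for the log-belief test. Unrolling the recursion,
`ℓ_i^{(t)} = ∑_{τ, j} (W ^ (t - τ))_{ij} (c / π_j) L_j(X_j^τ)` (`logBelief_eq_sum`). An irreducible
aperiodic stochastic matrix is primitive, hence its powers contract the `ℓ¹` norm of row vectors of
mass zero and `(W ^ k)_{ij} → π_j` (`IsStationary.tendsto_pow_apply`). The coefficients of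
`ℓ_i^{(t)} / c` thus tend to one as `t - τ` grows. For the threshold `-c t (D - δ)`, the weak law
sends the type-I error to zero. The Chernoff bound at `-1 / c` bounds the type-II error by
`exp (-t (D - δ) + ∑_{τ, j} Λ_j(-(W ^ (t - τ))_{ij} / π_j))`, where `Λ_j` is the cumulant generating
function of `L_j` under hypothesis `1`. Since `Λ_j` is finite on the nonpositive half-line, it is
continuous at `-1`, where it vanishes, and the sum is `o(t)` (`eventually_optTypeII_le_exp`).
-/

namespace DecentralizedDetection

open scoped ENNReal

/-! ### Powers of an irreducible aperiodic stochastic matrix -/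

/-- The return times of a state form an additive submonoid of `ℕ`, so if their greatest common
divisor is one, then every large time is a return time. -/
lemma IsAperiodic.eventually_pow_apply_self_pos {n : ℕ} {W : Matrix (Fin n) (Fin n) ℝ}
    (hW : IsAperiodic W) (hnn : ∀ i j, 0 ≤ W i j) (i : Fin n) :
    ∀ᶠ k in atTop, 0 < (W ^ k) i i := by
  let S : AddSubmonoid ℕ :=
    { carrier := {k | 0 < (W ^ k) i i}
      zero_mem' := by simp
      add_mem' := by
        intro a b ha hb
        simp only [Set.mem_ofPred_eq] at ha hb ⊢
        rw [pow_add, Matrix.mul_apply]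
        exact Finset.sum_pos' (fun l _ => mul_nonneg (Matrix.pow_apply_nonneg hnn a i l)
          (Matrix.pow_apply_nonneg hnn b l i)) ⟨i, Finset.mem_univ i, mul_pos ha hb⟩ }
  have hgcd : Nat.setGcd (S : Set ℕ) = 1 :=
    hW i _ fun k _ hk => Nat.setGcd_dvd_of_mem (s := (S : Set ℕ)) hk
  obtain ⟨N, hN⟩ := Nat.exists_mem_closure_of_ge (S : Set ℕ)
  filter_upwards [eventually_ge_atTop N] with k hk
  have : k ∈ S := by simpa using hN k hk (by simp [hgcd])
  exact this

lemma IsAperiodic.isPrimitive {n : ℕ} {W : Matrix (Fin n) (Fin n) ℝ}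
    (hW : IsAperiodic W) (hirr : W.IsIrreducible) : W.IsPrimitive := by
  have hnn := hirr.nonneg
  refine ⟨hnn, ?_⟩
  choose m _ hm using (Matrix.isIrreducible_iff_exists_pow_pos hnn).1 hirr
  have h : ∀ᶠ k in atTop, ∀ i j, 0 < (W ^ k) i j := by
    rw [eventually_all]
    intro i
    rw [eventually_all]
    intro j
    have h := (tendsto_sub_atTop_nat (m i j)).eventually
      (hW.eventually_pow_apply_self_pos hnn i)
    filter_upwards [h, eventually_ge_atTop (m i j)] with k hk hkm
    rw [← Nat.sub_add_cancel hkm, pow_add, Matrix.mul_apply]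
    exact Finset.sum_pos' (fun l _ => mul_nonneg (Matrix.pow_apply_nonneg hnn _ i l)
      (Matrix.pow_apply_nonneg hnn _ l j)) ⟨i, Finset.mem_univ i, mul_pos hk (hm i j)⟩
  obtain ⟨k, hk, hk'⟩ := (h.and (eventually_gt_atTop 0)).exists
  exact ⟨k, hk', hk⟩

section Contraction

variable {ι : Type*} [Fintype ι]

/-- Doeblin's contraction: a stochastic matrix whose entries are at least `δ` shrinks the `ℓ¹` norm
of a row vector of total mass zero by the factor `1 - |ι| δ`. -/
lemma sum_abs_vecMul_le {M : Matrix ι ι ℝ} {δ : ℝ} (hδ : ∀ i j, δ ≤ M i j)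
    (hsum : ∀ i, ∑ j, M i j = 1) {v : ι → ℝ} (hv : ∑ i, v i = 0) :
    ∑ j, |Matrix.vecMul v M j| ≤ (1 - Fintype.card ι * δ) * ∑ i, |v i| := by
  have h1 : ∀ j, Matrix.vecMul v M j = ∑ i, v i * (M i j - δ) := by
    intro j
    simp [Matrix.vecMul, dotProduct, mul_sub, Finset.sum_sub_distrib, ← Finset.sum_mul, hv]
  calc ∑ j, |Matrix.vecMul v M j| ≤ ∑ j, ∑ i, |v i| * (M i j - δ) := by
        refine Finset.sum_le_sum fun j _ => ?_
        rw [h1]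
        refine (Finset.abs_sum_le_sum_abs _ _).trans (Finset.sum_le_sum fun i _ => ?_)
        rw [abs_mul, abs_of_nonneg (sub_nonneg.2 (hδ i j))]
    _ = (1 - Fintype.card ι * δ) * ∑ i, |v i| := by
        rw [Finset.sum_comm, Finset.mul_sum]
        refine Finset.sum_congr rfl fun i _ => ?_
        rw [← Finset.mul_sum, Finset.sum_sub_distrib, hsum]
        simp [mul_comm]

lemma sum_vecMul_of_sum_row {M : Matrix ι ι ℝ} (hsum : ∀ i, ∑ j, M i j = 1) (v : ι → ℝ) :
    ∑ j, Matrix.vecMul v M j = ∑ i, v i := by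
  simp only [Matrix.vecMul, dotProduct]
  rw [Finset.sum_comm]
  simp [← Finset.mul_sum, hsum]

variable [DecidableEq ι]

lemma pow_mem_rowStochastic {W : Matrix ι ι ℝ} (hW : W ∈ Matrix.rowStochastic ℝ ι) (k : ℕ) :
    W ^ k ∈ Matrix.rowStochastic ℝ ι :=
  Submonoid.pow_mem _ hW k

/-- Row vectors of total mass zero are killed in the limit by the powers of a primitive stochastic
matrix: the `ℓ¹` norm never grows, and shrinks by a fixed factor over each block of steps at whose
length the matrix power is entrywise positive. -/
lemma tendsto_sum_abs_vecMul_pow [Nonempty ι] {W : Matrix ι ι ℝ}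
    (hW : W ∈ Matrix.rowStochastic ℝ ι) (hprim : W.IsPrimitive) {v : ι → ℝ}
    (hv : ∑ i, v i = 0) :
    Tendsto (fun k => ∑ j, |Matrix.vecMul v (W ^ k) j|) atTop (𝓝 0) := by
  have hmass : ∀ k, ∑ j, Matrix.vecMul v (W ^ k) j = 0 := fun k => by
    rw [sum_vecMul_of_sum_row
      (fun i => Matrix.sum_row_of_mem_rowStochastic (pow_mem_rowStochastic hW k) i), hv]
  have hanti : Antitone fun k => ∑ j, |Matrix.vecMul v (W ^ k) j| := by
    refine antitone_nat_of_succ_le fun k => ?_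
    rw [pow_succ, ← Matrix.vecMul_vecMul]
    simpa using sum_abs_vecMul_le (M := W) (δ := 0) (fun i j => hW.1 i j)
      (fun i => Matrix.sum_row_of_mem_rowStochastic hW i) (hmass k)
  obtain ⟨N, hN, hpos⟩ := hprim.exists_pos_pow
  -- The smallest entry of the positive power is the constant of the contraction.
  obtain ⟨p, hp⟩ := Finite.exists_min (fun p : ι × ι => (W ^ N) p.1 p.2)
  set δ := (W ^ N) p.1 p.2 with hδ
  have hδ0 : 0 < δ := hpos _ _
  have hrow := fun i => Matrix.sum_row_of_mem_rowStochastic (pow_mem_rowStochastic hW N) i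
  set q : ℝ := 1 - Fintype.card ι * δ with hq
  have hq1 : q < 1 := by
    have : (0 : ℝ) < Fintype.card ι := by exact_mod_cast Fintype.card_pos
    have := mul_pos this hδ0
    linarith
  have hq0 : 0 ≤ q := by
    have h : ∑ _j : ι, δ ≤ ∑ j, (W ^ N) p.1 j :=
      Finset.sum_le_sum fun j _ => hp (p.1, j)
    rw [hrow] at h
    simp only [Finset.sum_const, Finset.card_univ, nsmul_eq_mul] at h
    linarith
  have hgeo : ∀ m : ℕ, ∑ j, |Matrix.vecMul v (W ^ (N * m)) j| ≤ q ^ m * ∑ i, |v i| := by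
    intro m
    induction m with
    | zero => simp
    | succ m ih =>
      rw [Nat.mul_succ, pow_add, ← Matrix.vecMul_vecMul]
      refine (sum_abs_vecMul_le (fun i j => hp (i, j)) hrow (hmass _)).trans ?_
      rw [pow_succ', mul_assoc]
      exact mul_le_mul_of_nonneg_left ih hq0
  have hsub : Tendsto (fun m : ℕ => ∑ j, |Matrix.vecMul v (W ^ (N * m)) j|) atTop (𝓝 0) := by
    refine squeeze_zero (fun m => Finset.sum_nonneg fun _ _ => abs_nonneg _) hgeo ?_
    simpa using (tendsto_pow_atTop_nhds_zero_of_lt_one hq0 hq1).mul_const (∑ i, |v i|)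
  have hdiv : Tendsto (fun k : ℕ => k / N) atTop atTop := Nat.tendsto_div_const_atTop hN.ne'
  refine squeeze_zero (fun m => Finset.sum_nonneg fun _ _ => abs_nonneg _)
    (fun k => hanti (Nat.mul_div_le k N)) (hsub.comp hdiv)

end Contraction

lemma IsStationary.vecMul_pow {n : ℕ} {W : Matrix (Fin n) (Fin n) ℝ} {π : Fin n → ℝ}
    (hπ : IsStationary W π) (k : ℕ) : Matrix.vecMul π (W ^ k) = π := by
  induction k with
  | zero => simp
  | succ k ih => rw [pow_succ, ← Matrix.vecMul_vecMul, ih, hπ.2]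

lemma IsStationary.pos {n : ℕ} {W : Matrix (Fin n) (Fin n) ℝ} {π : Fin n → ℝ}
    (hπ : IsStationary W π) (hprim : W.IsPrimitive) (j : Fin n) : 0 < π j := by
  obtain ⟨N, _, hpos⟩ := hprim.exists_pos_pow
  obtain ⟨i, hi⟩ : ∃ i, 0 < π i := by
    by_contra! h
    have := Finset.sum_nonpos fun i (_ : i ∈ Finset.univ) => h i
    rw [hπ.1.2] at this
    linarith
  rw [← congrFun (hπ.vecMul_pow N) j]
  exact Finset.sum_pos' (fun l _ => mul_nonneg (hπ.1.1 l) (hpos l j).le)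
    ⟨i, Finset.mem_univ i, mul_pos hi (hpos i j)⟩

/-- The difference of the rows `e_i W ^ k` and `π = π W ^ k` is the image under `W ^ k` of the row
vector `e_i - π` of mass zero. -/
lemma IsStationary.tendsto_pow_apply {n : ℕ} {W : Matrix (Fin n) (Fin n) ℝ} {π : Fin n → ℝ}
    (hπ : IsStationary W π) (hW : W ∈ Matrix.rowStochastic ℝ (Fin n)) (hprim : W.IsPrimitive)
    (i j : Fin n) : Tendsto (fun k => (W ^ k) i j) atTop (𝓝 (π j)) := by
  have : Nonempty (Fin n) := ⟨i⟩
  have hv : ∑ l, ((Pi.single i 1 : Fin n → ℝ) - π) l = 0 := by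
    simp [Finset.sum_sub_distrib, hπ.1.2]
  rw [tendsto_iff_norm_sub_tendsto_zero]
  refine squeeze_zero (fun k => norm_nonneg _) (fun k => ?_)
    (tendsto_sum_abs_vecMul_pow hW hprim hv)
  refine le_trans (le_of_eq ?_) (Finset.single_le_sum (fun l _ => abs_nonneg _) (Finset.mem_univ j))
  simp [Matrix.sub_vecMul, hπ.vecMul_pow]

/-! ### Change of measure for independent observations -/

section ChangeOfMeasure

variable {ι : Type*} [Fintype ι] {β : ι → Type*} [∀ i, MeasurableSpace (β i)]
  {μ ν : ∀ i, Measure (β i)} [∀ i, IsProbabilityMeasure (μ i)] [∀ i, IsProbabilityMeasure (ν i)]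

lemma lintegral_pi_prod_eq_prod_lintegral {f : ∀ i, β i → ℝ≥0∞} (hf : ∀ i, Measurable (f i)) :
    ∫⁻ x, ∏ i, f i (x i) ∂(Measure.pi μ) = ∏ i, ∫⁻ y, f i y ∂(μ i) := by
  rw [lintegral_prod_eq_prod_lintegral_of_indepFun Finset.univ (fun i (x : ∀ i, β i) => f i (x i))
    (iIndepFun_pi fun i => (hf i).aemeasurable) (fun i => (hf i).comp (measurable_pi_apply i))]
  exact Finset.prod_congr rfl fun i _ =>
    (measurePreserving_eval μ i).lintegral_comp (hf i)

lemma pi_eq_withDensity_prod_rnDeriv (hνμ : ∀ i, ν i ≪ μ i) :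
    Measure.pi ν = (Measure.pi μ).withDensity fun x => ∏ i, (ν i).rnDeriv (μ i) (x i) := by
  refine Measure.pi_eq fun s hs => ?_
  rw [withDensity_apply _ (MeasurableSet.univ_pi hs),
    ← lintegral_indicator (MeasurableSet.univ_pi hs)]
  have h : ∀ x : ∀ i, β i, (Set.univ.pi s).indicator
      (fun x => ∏ i, (ν i).rnDeriv (μ i) (x i)) x =
      ∏ i, (s i).indicator ((ν i).rnDeriv (μ i)) (x i) := by
    intro x
    by_cases hx : x ∈ Set.univ.pi s
    · rw [Set.indicator_of_mem hx]
      exact Finset.prod_congr rfl fun i _ => by rw [Set.indicator_of_mem (hx i trivial)]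
    · rw [Set.indicator_of_notMem hx]
      simp only [Set.mem_pi, Set.mem_univ, true_implies, not_forall] at hx
      obtain ⟨i, hi⟩ := hx
      exact (Finset.prod_eq_zero (Finset.mem_univ i) (Set.indicator_of_notMem hi _)).symm
  simp_rw [h]
  rw [lintegral_pi_prod_eq_prod_lintegral
    fun i => (Measure.measurable_rnDeriv _ _).indicator (hs i)]
  refine Finset.prod_congr rfl fun i _ => ?_
  rw [lintegral_indicator (hs i), Measure.setLIntegral_rnDeriv (hνμ i)]

variable {Ω : Type*} [MeasurableSpace Ω] {p q : Measure Ω} [IsProbabilityMeasure p]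
  [IsProbabilityMeasure q] {Z : ∀ i, Ω → β i}

/-- The likelihood ratio of independent observations is the exponential of the sum of the
individual log-likelihood ratios. -/
lemma lintegral_comp_eq_lintegral_exp_sum_llr (hνμ : ∀ i, ν i ≪ μ i) (hμν : ∀ i, μ i ≪ ν i)
    (hZ : ∀ i, Measurable (Z i)) (hp : iIndepFun Z p) (hq : iIndepFun Z q)
    (hpμ : ∀ i, p.map (Z i) = μ i) (hqν : ∀ i, q.map (Z i) = ν i)
    {ψ : (∀ i, β i) → ℝ≥0∞} (hψ : Measurable ψ) :
    ∫⁻ ω, ψ (fun i => Z i ω) ∂q =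
      ∫⁻ ω, ENNReal.ofReal (Real.exp (∑ i, llr (ν i) (μ i) (Z i ω))) * ψ (fun i => Z i ω) ∂p := by
  have hZ' : Measurable fun ω i => Z i ω := measurable_pi_lambda _ hZ
  have hp' : p.map (fun ω i => Z i ω) = Measure.pi μ := by
    rw [(iIndepFun_iff_map_fun_eq_pi_map fun i => (hZ i).aemeasurable).1 hp]
    simp_rw [hpμ]
  have hq' : q.map (fun ω i => Z i ω) = Measure.pi ν := by
    rw [(iIndepFun_iff_map_fun_eq_pi_map fun i => (hZ i).aemeasurable).1 hq]
    simp_rw [hqν]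
  have hmeas : Measurable fun x : ∀ i, β i => ∏ i, (ν i).rnDeriv (μ i) (x i) :=
    Finset.measurable_prod _ fun i _ =>
      (Measure.measurable_rnDeriv _ _).comp (measurable_pi_apply i)
  have h1 : ∫⁻ ω, ψ (fun i => Z i ω) ∂q = ∫⁻ x, ψ x ∂(Measure.pi ν) := by
    rw [← hq', lintegral_map hψ hZ']
  rw [h1, pi_eq_withDensity_prod_rnDeriv hνμ, lintegral_withDensity_eq_lintegral_mul _ hmeas hψ,
    ← hp', lintegral_map (hmeas.mul hψ) hZ']
  refine lintegral_congr_ae ?_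
  have hae : ∀ᵐ ω ∂p, ∀ i, Real.exp (llr (ν i) (μ i) (Z i ω)) =
      ((ν i).rnDeriv (μ i) (Z i ω)).toReal ∧ (ν i).rnDeriv (μ i) (Z i ω) < ∞ := by
    rw [ae_all_iff]
    intro i
    have h := (exp_llr_of_ac' (ν i) (μ i) (hμν i)).and (Measure.rnDeriv_lt_top (ν i) (μ i))
    rw [← hpμ i] at h
    rw [← hpμ i]
    exact ae_of_ae_map (hZ i).aemeasurable h
  filter_upwards [hae] with ω hω
  simp only [Pi.mul_apply]
  congr 1
  rw [Real.exp_sum, ENNReal.ofReal_prod_of_nonneg fun i _ => (Real.exp_pos _).le]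
  exact Finset.prod_congr rfl fun i _ => by rw [(hω i).1, ENNReal.ofReal_toReal (hω i).2.ne]

/-- A test of type-I error at most `ε` has type-II error at least
`exp (-A) * (1 - ε - p {S < -A})`, where `S` is the total log-likelihood ratio: off the event
`{S < -A}`, the likelihood ratio is at least `exp (-A)`. -/
lemma exp_neg_mul_le_integral_one_sub (hνμ : ∀ i, ν i ≪ μ i) (hμν : ∀ i, μ i ≪ ν i)
    (hZ : ∀ i, Measurable (Z i)) (hp : iIndepFun Z p) (hq : iIndepFun Z q)
    (hpμ : ∀ i, p.map (Z i) = μ i) (hqν : ∀ i, q.map (Z i) = ν i)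
    {φ : (∀ i, β i) → ℝ} (hφ : Measurable φ) (hφ01 : ∀ x, φ x ∈ Set.Icc (0 : ℝ) 1)
    {ε : ℝ} (hε : ∫ ω, φ (fun i => Z i ω) ∂p ≤ ε) (A : ℝ) :
    Real.exp (-A) * (1 - ε - p.real {ω | ∑ i, llr (ν i) (μ i) (Z i ω) < -A}) ≤
      ∫ ω, (1 - φ (fun i => Z i ω)) ∂q := by
  set S : Ω → ℝ := fun ω => ∑ i, llr (ν i) (μ i) (Z i ω) with hS
  have hSm : Measurable S :=
    Finset.measurable_sum _ fun i _ => (measurable_llr _ _).comp (hZ i)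
  have hZ' : Measurable fun ω i => Z i ω := measurable_pi_lambda _ hZ
  have hφZ : Measurable fun ω => φ (fun i => Z i ω) := hφ.comp hZ'
  have hnn : ∀ ω, 0 ≤ 1 - φ (fun i => Z i ω) := fun ω => sub_nonneg.2 (hφ01 _).2
  have hint : ∀ m : Measure Ω, IsProbabilityMeasure m →
      Integrable (fun ω => φ (fun i => Z i ω)) m := fun m _ =>
    Integrable.of_bound hφZ.aestronglyMeasurable 1 (ae_of_all _ fun ω => by
      rw [Real.norm_eq_abs, abs_of_nonneg (hφ01 _).1]; exact (hφ01 _).2)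
  have hset : MeasurableSet {ω | S ω < -A} := measurableSet_lt hSm measurable_const
  have hlin : ∫⁻ ω, ENNReal.ofReal (1 - φ (fun i => Z i ω)) ∂q =
      ∫⁻ ω, ENNReal.ofReal (Real.exp (S ω) * (1 - φ (fun i => Z i ω))) ∂p := by
    rw [lintegral_comp_eq_lintegral_exp_sum_llr hνμ hμν hZ hp hq hpμ hqν
      (ψ := fun x => ENNReal.ofReal (1 - φ x)) (measurable_const.sub hφ).ennreal_ofReal]
    exact lintegral_congr fun ω => (ENNReal.ofReal_mul (Real.exp_pos _).le).symm
  have hmeas : Measurable fun ω => Real.exp (S ω) * (1 - φ (fun i => Z i ω)) :=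
    hSm.exp.mul (measurable_const.sub hφZ)
  have hnn' : ∀ ω, 0 ≤ Real.exp (S ω) * (1 - φ (fun i => Z i ω)) :=
    fun ω => mul_nonneg (Real.exp_pos _).le (hnn ω)
  have hone : Integrable (fun ω => 1 - φ (fun i => Z i ω)) q :=
    (integrable_const _).sub (hint q inferInstance)
  have hone' : Integrable (fun ω => 1 - φ (fun i => Z i ω)) p :=
    (integrable_const _).sub (hint p inferInstance)
  have hint' : Integrable (fun ω => Real.exp (S ω) * (1 - φ (fun i => Z i ω))) p := by
    refine ⟨hmeas.aestronglyMeasurable, ?_⟩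
    rw [hasFiniteIntegral_iff_ofReal (ae_of_all _ hnn'), ← hlin,
      ← hasFiniteIntegral_iff_ofReal (ae_of_all _ hnn)]
    exact hone.2
  have heq : ∫ ω, (1 - φ (fun i => Z i ω)) ∂q =
      ∫ ω, Real.exp (S ω) * (1 - φ (fun i => Z i ω)) ∂p := by
    rw [integral_eq_lintegral_of_nonneg_ae (ae_of_all _ hnn) hone.1,
      integral_eq_lintegral_of_nonneg_ae (ae_of_all _ hnn') hmeas.aestronglyMeasurable, hlin]
  have hind : Integrable (fun ω => {ω | S ω < -A}.indicator (fun _ => (1 : ℝ)) ω) p :=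
    (integrable_const _).indicator hset
  have hleft : ∫ ω, Real.exp (-A) * ((1 - φ (fun i => Z i ω)) -
      {ω | S ω < -A}.indicator (fun _ => (1 : ℝ)) ω) ∂p =
      Real.exp (-A) * (1 - ∫ ω, φ (fun i => Z i ω) ∂p - p.real {ω | S ω < -A}) := by
    rw [integral_const_mul, integral_sub hone' hind,
      integral_sub (integrable_const _) (hint p inferInstance), integral_indicator_const _ hset]
    simp
  calc Real.exp (-A) * (1 - ε - p.real {ω | S ω < -A})
      ≤ Real.exp (-A) * (1 - ∫ ω, φ (fun i => Z i ω) ∂p - p.real {ω | S ω < -A}) := by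
        gcongr
    _ ≤ ∫ ω, Real.exp (S ω) * (1 - φ (fun i => Z i ω)) ∂p := by
        rw [← hleft]
        refine integral_mono ((hone'.sub hind).const_mul _) hint' fun ω => ?_
        by_cases hω : S ω < -A
        · refine le_trans ?_ (hnn' ω)
          rw [Set.indicator_of_mem (by exact hω)]
          exact mul_nonpos_of_nonneg_of_nonpos (Real.exp_pos _).le
            (by linarith [(hφ01 (fun i => Z i ω)).1])
        · simp only [Set.indicator_of_notMem (s := {ω | S ω < -A}) (by exact hω), sub_zero]
          exact mul_le_mul_of_nonneg_right (Real.exp_le_exp.2 (not_lt.1 hω)) (hnn ω)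
    _ = _ := heq.symm

end ChangeOfMeasure

/-! ### Concentration of weighted sums of independent variables -/

/-- Chebyshev's inequality for weighted sums of independent variables. -/
lemma measureReal_ge_abs_weighted_sum_sub_le {Ω κ : Type*} [MeasurableSpace Ω] {μ : Measure Ω}
    [IsProbabilityMeasure μ] {Y : κ → Ω → ℝ} (hindep : iIndepFun Y μ)
    (hY : ∀ k, MemLp (Y k) 2 μ) {V C : ℝ} (hV : ∀ k, Var[Y k; μ] ≤ V)
    (s : Finset κ) {a : κ → ℝ} (ha : ∀ k ∈ s, |a k| ≤ C) {K : ℝ} (hK : 0 < K) :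
    μ.real {ω | K ≤ |∑ k ∈ s, a k * Y k ω - ∑ k ∈ s, a k * ∫ ω, Y k ω ∂μ|} ≤
      s.card * (C ^ 2 * V) / K ^ 2 := by
  have hLp : ∀ k, MemLp (fun ω => a k * Y k ω) 2 μ := fun k => (hY k).const_mul _
  have hsum : (fun ω => ∑ k ∈ s, a k * Y k ω) = ∑ k ∈ s, fun ω => a k * Y k ω := by
    ext ω; simp
  have hLps : MemLp (fun ω => ∑ k ∈ s, a k * Y k ω) 2 μ := by
    rw [hsum]; exact memLp_finsetSum' _ fun k _ => hLp k
  have hmean : ∫ ω, ∑ k ∈ s, a k * Y k ω ∂μ = ∑ k ∈ s, a k * ∫ ω, Y k ω ∂μ := by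
    rw [integral_finsetSum _ fun k _ => (hLp k).integrable (by norm_num)]
    simp_rw [integral_const_mul]
  have hvar : Var[fun ω => ∑ k ∈ s, a k * Y k ω; μ] ≤ s.card * (C ^ 2 * V) := by
    rw [hsum, IndepFun.variance_sum (fun k _ => hLp k)]
    · refine (Finset.sum_le_card_nsmul s _ (C ^ 2 * V) fun k hk => ?_).trans (by simp)
      rw [variance_const_mul]
      refine mul_le_mul ?_ (hV k) (variance_nonneg _ _) (sq_nonneg _)
      rw [← sq_abs]
      exact pow_le_pow_left₀ (abs_nonneg _) (ha k hk) 2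
    · intro k _ l _ hkl
      exact (hindep.indepFun hkl).comp (measurable_const_mul (a k)) (measurable_const_mul (a l))
  have h := meas_ge_le_variance_div_sq hLps hK
  rw [hmean] at h
  refine ENNReal.toReal_le_of_le_ofReal (div_nonneg ?_ (sq_nonneg _)) (h.trans ?_)
  · exact (variance_nonneg _ _).trans hvar
  · gcongr

/-! ### Moments of the log-likelihood ratio -/

section Moments

variable {α : Type*} [MeasurableSpace α] {μ ν : Measure α} [IsProbabilityMeasure μ]
  [IsProbabilityMeasure ν]

/-- Changing measure trades the exponential moment at `-2` under `ν` for the one at `-1` under `μ`,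
while the one at `1` under `μ` always exists. -/
lemma memLp_two_llr (hμν : μ ≪ ν) (hνμ : ν ≪ μ)
    (h : Integrable (fun x => Real.exp (-2 * llr ν μ x)) ν) : MemLp (llr ν μ) 2 μ := by
  have h1 : (1 : ℝ) ∈ integrableExpSet (llr ν μ) μ := by
    refine (Measure.integrable_toReal_rnDeriv (μ := ν) (ν := μ)).congr ?_
    filter_upwards [exp_llr_of_ac' ν μ hμν] with x hx
    rw [one_mul, hx]
  have h2 : (-1 : ℝ) ∈ integrableExpSet (llr ν μ) μ := by
    have : Integrable (fun x => (μ.rnDeriv ν x).toReal • Real.exp (-1 * llr ν μ x)) ν := by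
      refine h.congr ?_
      filter_upwards [exp_neg_llr hνμ] with x hx
      rw [← hx, smul_eq_mul, ← Real.exp_add]
      congr 1
      ring
    exact (integrable_rnDeriv_smul_iff hμν).1 this
  refine memLp_of_mem_interior_integrableExpSet ?_ 2
  have hsub : Set.Icc (-1 : ℝ) 1 ⊆ integrableExpSet (llr ν μ) μ :=
    convex_integrableExpSet.ordConnected.out h2 h1
  exact interior_mono hsub (by rw [interior_Icc]; norm_num)

lemma klDiv_ne_top_of_memLp_llr (hμν : μ ≪ ν) (h : MemLp (llr ν μ) 2 μ) :
    InformationTheory.klDiv μ ν ≠ ⊤ := by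
  refine InformationTheory.klDiv_ne_top hμν ?_
  refine ((h.integrable (by norm_num)).neg).congr ?_
  filter_upwards [neg_llr hμν] with x hx
  rw [Pi.neg_apply, ← hx, Pi.neg_apply, neg_neg]

lemma integral_llr_eq_neg_toReal_klDiv (hμν : μ ≪ ν) :
    ∫ x, llr ν μ x ∂μ = -(InformationTheory.klDiv μ ν).toReal := by
  rw [InformationTheory.toReal_klDiv_of_measure_eq hμν (by simp), ← integral_neg]
  exact integral_congr_ae (neg_llr hμν).symm

/-- The cumulant generating function under `ν` of the log-likelihood ratio vanishes at `-1`, because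
`exp (-llr ν μ)` is the density of `μ` with respect to `ν`, and is continuous there, because `-1` is
interior to its domain of finiteness. -/
lemma tendsto_cgf_llr (hμν : μ ≪ ν) (hνμ : ν ≪ μ)
    (h : ∀ s ≤ (0 : ℝ), Integrable (fun x => Real.exp (s * llr ν μ x)) ν) :
    Tendsto (cgf (llr ν μ) ν) (𝓝 (-1)) (𝓝 0) := by
  have hint : (-1 : ℝ) ∈ interior (integrableExpSet (llr ν μ) ν) :=
    interior_mono (s := Set.Iic 0) (fun s hs => h s hs) (by rw [interior_Iic]; norm_num)
  have hcont : ContinuousAt (cgf (llr ν μ) ν) (-1) :=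
    (analyticAt_cgf hint).continuousAt
  have h0 : cgf (llr ν μ) ν (-1) = 0 := by
    have : ∫ x, Real.exp (-1 * llr ν μ x) ∂ν = 1 := by
      have h1 := integral_congr_ae (exp_neg_llr hνμ)
      simp only [neg_one_mul]
      rw [h1, Measure.integral_toReal_rnDeriv hμν]
      simp
    rw [cgf, mgf, this, Real.log_one]
  simpa [h0] using hcont.tendsto

end Moments

/-! ### Log-beliefs as weighted sums of log-likelihood ratios -/

section LogBelief

variable {n : ℕ} {𝒳 : Fin n → Type*} [∀ j, MeasurableSpace (𝒳 j)]

lemma logBelief_eq_sum (W : Matrix (Fin n) (Fin n) ℝ) (P : Fin 2 → ∀ j, Measure (𝒳 j))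
    (r : Fin n → ℝ) (x : ℕ → ∀ j, 𝒳 j) (t : ℕ) (i : Fin n) :
    logBelief W P r x t i = ∑ p ∈ Finset.range t ×ˢ Finset.univ,
      ((W ^ (t - p.1)) i p.2 * r p.2) * llr (P 1 p.2) (P 0 p.2) (x p.1 p.2) := by
  rw [Finset.sum_product]
  induction t generalizing i with
  | zero => simp [logBelief]
  | succ t ih =>
    simp only [logBelief, localLogBelief, mul_add, Finset.sum_add_distrib, ih]
    rw [Finset.sum_range_succ, add_comm]
    congr 1
    · simp_rw [Finset.mul_sum]
      rw [Finset.sum_comm]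
      refine Finset.sum_congr rfl fun τ hτ => ?_
      rw [Finset.sum_comm]
      refine Finset.sum_congr rfl fun k _ => ?_
      rw [Nat.succ_sub (Finset.mem_range.1 hτ).le, pow_succ', Matrix.mul_apply, Finset.sum_mul,
        Finset.sum_mul]
      exact Finset.sum_congr rfl fun j _ => by ring
    · simp [mul_assoc]

lemma sum_range_product_univ {t : ℕ} (f : ℕ → Fin n → ℝ) :
    ∑ p ∈ Finset.range t ×ˢ Finset.univ, f p.1 p.2 = ∑ p : Fin t × Fin n, f p.1 p.2 := by
  rw [Finset.sum_product, Fintype.sum_prod_type, Finset.sum_range]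

/-- The log-belief after `t` rounds is a measurable function of the samples of these rounds. -/
lemma exists_measurable_logBelief_eq (W : Matrix (Fin n) (Fin n) ℝ)
    (P : Fin 2 → ∀ j, Measure (𝒳 j)) (r : Fin n → ℝ) (t : ℕ) (i : Fin n) :
    ∃ G : (Fin t → ∀ j, 𝒳 j) → ℝ, Measurable G ∧
      ∀ x : ℕ → ∀ j, 𝒳 j, logBelief W P r x t i = G (fun τ j => x τ j) := by
  refine ⟨fun y => ∑ p : Fin t × Fin n,
    ((W ^ (t - p.1)) i p.2 * r p.2) * llr (P 1 p.2) (P 0 p.2) (y p.1 p.2), ?_, fun x => ?_⟩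
  · refine Finset.measurable_sum _ fun p _ => ((measurable_llr _ _).comp ?_).const_mul _
    exact (measurable_pi_apply p.2).comp (measurable_pi_apply p.1)
  · rw [logBelief_eq_sum]
    exact sum_range_product_univ fun τ j =>
      ((W ^ (t - τ)) i j * r j) * llr (P 1 j) (P 0 j) (x τ j)

end LogBelief

/-! ### Cesàro averages and the weak law -/

/-- Cesàro averages of a convergent family of sequences, read backwards in time: round `τ` has
weight `W ^ (t - τ)` in the log-belief at time `t`. -/
lemma tendsto_inv_mul_sum_range_product {n : ℕ} {F : ℕ → Fin n → ℝ} {l : Fin n → ℝ}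
    (h : ∀ j, Tendsto (fun k => F k j) atTop (𝓝 (l j))) :
    Tendsto (fun t : ℕ => (t : ℝ)⁻¹ *
      ∑ p ∈ Finset.range t ×ˢ Finset.univ, F (t - p.1) p.2) atTop (𝓝 (∑ j, l j)) := by
  have h1 : Tendsto (fun k => ∑ j, F (k + 1) j) atTop (𝓝 (∑ j, l j)) :=
    tendsto_finsetSum _ fun j _ => (h j).comp (tendsto_add_atTop_nat 1)
  refine h1.cesaro.congr fun t => ?_
  congr 1
  rw [Finset.sum_product, ← Finset.sum_range_reflect]
  refine Finset.sum_congr rfl fun τ hτ => ?_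
  have : t - 1 - τ + 1 = t - τ := by have := Finset.mem_range.1 hτ; omega
  rw [this]

lemma tendsto_measureReal_weighted_sum {n : ℕ} {Ω : Type*} [MeasurableSpace Ω] {μ : Measure Ω}
    [IsProbabilityMeasure μ] {Y : ℕ × Fin n → Ω → ℝ} (hindep : iIndepFun Y μ)
    (hY : ∀ k, MemLp (Y k) 2 μ) {V C : ℝ} (hV : ∀ k, Var[Y k; μ] ≤ V)
    {a : ℕ → ℕ × Fin n → ℝ} (ha : ∀ t p, |a t p| ≤ C) {δ : ℝ} (hδ : 0 < δ) :
    Tendsto (fun t : ℕ => μ.real {ω | t * δ ≤ |∑ p ∈ Finset.range t ×ˢ Finset.univ, a t p * Y p ω -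
      ∑ p ∈ Finset.range t ×ˢ Finset.univ, a t p * ∫ ω, Y p ω ∂μ|}) atTop (𝓝 0) := by
  have hlim : Tendsto (fun t : ℕ => (n * (C ^ 2 * V) / δ ^ 2) * (t : ℝ)⁻¹) atTop (𝓝 0) := by
    simpa using (tendsto_inv_atTop_nhds_zero_nat (𝕜 := ℝ)).const_mul (n * (C ^ 2 * V) / δ ^ 2)
  refine squeeze_zero' (Eventually.of_forall fun t => measureReal_nonneg) ?_ hlim
  filter_upwards [eventually_gt_atTop 0] with t ht
  have ht' : (0 : ℝ) < t := by exact_mod_cast ht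
  refine (measureReal_ge_abs_weighted_sum_sub_le hindep hY hV _ (fun p _ => ha t p)
    (mul_pos ht' hδ)).trans (le_of_eq ?_)
  rw [Finset.card_product, Finset.card_range, Finset.card_univ, Fintype.card_fin]
  push_cast
  field_simp

lemma exists_measureReal_lt_neg_le {Ω : Type*} [MeasurableSpace Ω] (μ : Measure Ω)
    [IsProbabilityMeasure μ] {S : Ω → ℝ} (hS : Measurable S) {ε : ℝ} (hε : 0 < ε) :
    ∃ A : ℝ, μ.real {ω | S ω < -A} ≤ ε := by
  have := Measure.isProbabilityMeasure_map hS.aemeasurable (μ := μ)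
  obtain ⟨a, ha⟩ := ((tendsto_cdf_atBot (μ.map S)).eventually (eventually_le_nhds hε)).exists
  refine ⟨-a, le_trans ?_ ha⟩
  rw [cdf_eq_real, map_measureReal_apply hS measurableSet_Iic]
  refine measureReal_mono fun ω hω => ?_
  simp only [Set.mem_ofPred_eq, neg_neg] at hω
  exact hω.le

/-! ### Bounds on the optimal type-II errors -/

section Bounds

variable {n : ℕ} {𝒳 : Fin n → Type*} [∀ j, MeasurableSpace (𝒳 j)] {Ω : Type*} [MeasurableSpace Ω]
  {P : Fin 2 → ∀ j, Measure (𝒳 j)} {Pr : Fin 2 → Measure Ω} {X : ℕ → ∀ j, Ω → 𝒳 j}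

lemma optTypeII_le_typeIIError (W : Matrix (Fin n) (Fin n) ℝ) (r : Fin n → ℝ) {ε η γ : ℝ}
    (i : Fin n) (t : ℕ) (hη : η ∈ Set.Icc (0 : ℝ) 1)
    (h : typeIError Pr (fun ω => logBelief W P r (fun τ j => X τ j ω) t i) η γ ≤ ε) :
    optTypeII W P Pr X r ε i t ≤
      typeIIError Pr (fun ω => logBelief W P r (fun τ j => X τ j ω) t i) η γ := by
  refine csInf_le ⟨0, ?_⟩ ⟨η, hη, γ, h, rfl⟩
  rintro _ ⟨η', hη', γ', -, rfl⟩
  exact add_nonneg measureReal_nonneg (mul_nonneg (sub_nonneg.2 hη'.2) measureReal_nonneg)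

lemma iIndepFun_llr (hindep : ∀ θ, iIndepFun (fun p : ℕ × Fin n => X p.1 p.2) (Pr θ)) (θ : Fin 2) :
    iIndepFun (fun (p : ℕ × Fin n) ω => llr (P 1 p.2) (P 0 p.2) (X p.1 p.2 ω)) (Pr θ) :=
  (hindep θ).comp (fun p => llr (P 1 p.2) (P 0 p.2)) fun _ => measurable_llr _ _

variable [∀ θ, IsProbabilityMeasure (Pr θ)]

/-- Threshold tests on a statistic of the first `t` rounds compete in the centralized problem. -/
lemma optTypeIICentralized_le_typeIIError (hX : ∀ τ j, Measurable (X τ j)) {t : ℕ}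
    {G : (Fin t → ∀ j, 𝒳 j) → ℝ} (hG : Measurable G) {η γ ε : ℝ} (hη : η ∈ Set.Icc (0 : ℝ) 1)
    (h : typeIError Pr (fun ω => G fun τ j => X τ j ω) η γ ≤ ε) :
    optTypeIICentralized Pr X ε t ≤ typeIIError Pr (fun ω => G fun τ j => X τ j ω) η γ := by
  have hXm : Measurable fun ω (τ : Fin t) j => X τ j ω :=
    measurable_pi_lambda _ fun τ => measurable_pi_lambda _ fun j => hX τ j
  have hGX : Measurable fun ω => G fun τ j => X τ j ω := hG.comp hXm
  have hgt : MeasurableSet {ω | γ < G fun τ j => X τ j ω} := measurableSet_lt measurable_const hGX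
  have heq : MeasurableSet {ω | (G fun τ j => X τ j ω) = γ} :=
    measurableSet_eq_fun hGX measurable_const
  have hlt : MeasurableSet {ω | (G fun τ j => X τ j ω) < γ} := measurableSet_lt hGX measurable_const
  have hcomb : ∀ (m : Measure Ω) [IsProbabilityMeasure m] {A B : Set Ω} (b : ℝ), MeasurableSet A →
      MeasurableSet B → ∫ ω, (A.indicator (fun _ => (1 : ℝ)) ω +
        b * B.indicator (fun _ => (1 : ℝ)) ω) ∂m = m.real A + b * m.real B := by
    intro m _ A B b hA hB
    rw [integral_add ((integrable_const _).indicator hA)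
      (((integrable_const _).indicator hB).const_mul b), integral_const_mul,
      integral_indicator_const _ hA, integral_indicator_const _ hB]
    simp
  let φ : (Fin t → ∀ j, 𝒳 j) → ℝ := fun x => if γ < G x then 1 else if G x = γ then η else 0
  refine csInf_le ⟨0, ?_⟩ ⟨φ, ?_, fun x => ?_, ?_, ?_⟩
  · rintro _ ⟨φ, -, hφ, -, rfl⟩
    exact integral_nonneg fun ω => sub_nonneg.2 (hφ _).2
  · exact Measurable.ite (measurableSet_lt measurable_const hG) measurable_const
      (Measurable.ite (measurableSet_eq_fun hG measurable_const) measurable_const measurable_const)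
  · simp only [φ]
    split_ifs
    · simp
    · exact hη
    · simp
  · refine le_trans (le_of_eq ?_) h
    rw [typeIError, ← hcomb (Pr 0) η hgt heq]
    refine integral_congr_ae (ae_of_all _ fun ω => ?_)
    rcases lt_trichotomy γ (G fun τ j => X τ j ω) with h | h | h
    · simp [φ, h, h.ne']
    · simp [φ, ← h]
    · simp [φ, h.ne, h.not_gt]
  · rw [typeIIError, ← hcomb (Pr 1) (1 - η) hlt heq]
    refine integral_congr_ae (ae_of_all _ fun ω => ?_)
    rcases lt_trichotomy γ (G fun τ j => X τ j ω) with h | h | h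
    · simp [φ, h, h.ne', h.not_gt]
    · simp [φ, ← h]
    · simp [φ, h, h.ne, h.not_gt]

lemma optTypeIICentralized_le_optTypeII (hX : ∀ τ j, Measurable (X τ j))
    (W : Matrix (Fin n) (Fin n) ℝ) (r : Fin n → ℝ) {ε : ℝ} (hε : 0 < ε) (i : Fin n) (t : ℕ) :
    optTypeIICentralized Pr X ε t ≤ optTypeII W P Pr X r ε i t := by
  obtain ⟨G, hG, hGeq⟩ := exists_measurable_logBelief_eq W P r t i
  have hXm : Measurable fun ω (τ : Fin t) j => X τ j ω :=
    measurable_pi_lambda _ fun τ => measurable_pi_lambda _ fun j => hX τ j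
  unfold optTypeII
  simp_rw [hGeq]
  refine le_csInf ?_ ?_
  · -- A sufficiently high threshold meets any positive type-I level.
    obtain ⟨γ, hγ⟩ := exists_measureReal_lt_neg_le (Pr 0) (hG.comp hXm).neg hε
    refine ⟨_, 0, by simp, γ, ?_, rfl⟩
    simpa [typeIError] using hγ
  · rintro _ ⟨η, hη, γ, h, rfl⟩
    exact optTypeIICentralized_le_typeIIError hX hG hη h

variable [∀ θ j, IsProbabilityMeasure (P θ j)]

lemma exp_neg_mul_le_optTypeIICentralized (hac01 : ∀ j, P 0 j ≪ P 1 j)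
    (hac10 : ∀ j, P 1 j ≪ P 0 j) (hX : ∀ τ j, Measurable (X τ j))
    (hlaw : ∀ θ τ j, (Pr θ).map (X τ j) = P θ j)
    (hindep : ∀ θ, iIndepFun (fun p : ℕ × Fin n => X p.1 p.2) (Pr θ)) {ε : ℝ} (hε : 0 ≤ ε)
    (t : ℕ) (A : ℝ) :
    Real.exp (-A) * (1 - ε - (Pr 0).real {ω | ∑ p ∈ Finset.range t ×ˢ Finset.univ,
      llr (P 1 p.2) (P 0 p.2) (X p.1 p.2 ω) < -A}) ≤ optTypeIICentralized Pr X ε t := by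
  have hinj : Function.Injective fun p : Fin t × Fin n => ((p.1 : ℕ), p.2) := by
    rintro ⟨a, b⟩ ⟨c, d⟩ h
    simpa [Fin.ext_iff] using h
  have hind := fun θ => (hindep θ).precomp hinj
  refine le_csInf ⟨_, fun _ => 0, measurable_const, by simp, by simpa using hε, rfl⟩ ?_
  rintro _ ⟨φ, hφ, hφ01, hφε, rfl⟩
  have hcurry : Measurable fun (y : ∀ p : Fin t × Fin n, 𝒳 p.2) τ j => y (τ, j) :=
    measurable_pi_lambda _ fun τ => measurable_pi_lambda _ fun j => measurable_pi_apply (τ, j)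
  have h := exp_neg_mul_le_integral_one_sub (μ := fun p : Fin t × Fin n => P 0 p.2)
    (ν := fun p => P 1 p.2) (Z := fun p => X p.1 p.2) (fun p => hac10 p.2) (fun p => hac01 p.2)
    (fun p => hX p.1 p.2) (hind 0) (hind 1) (fun p => hlaw 0 p.1 p.2) (fun p => hlaw 1 p.1 p.2)
    (φ := fun y => φ fun τ j => y (τ, j)) (hφ.comp hcurry) (fun _ => hφ01 _) hφε A
  refine le_trans (le_of_eq ?_) h
  congr 4
  ext ω
  rw [sum_range_product_univ fun τ j => llr (P 1 j) (P 0 j) (X τ j ω)]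

lemma optTypeIICentralized_pos (hac01 : ∀ j, P 0 j ≪ P 1 j)
    (hac10 : ∀ j, P 1 j ≪ P 0 j) (hX : ∀ τ j, Measurable (X τ j))
    (hlaw : ∀ θ τ j, (Pr θ).map (X τ j) = P θ j)
    (hindep : ∀ θ, iIndepFun (fun p : ℕ × Fin n => X p.1 p.2) (Pr θ)) {ε : ℝ}
    (hε : ε ∈ Set.Ioo (0 : ℝ) 1) (t : ℕ) : 0 < optTypeIICentralized Pr X ε t := by
  have hS : Measurable fun ω => ∑ p ∈ Finset.range t ×ˢ Finset.univ,
      llr (P 1 p.2) (P 0 p.2) (X p.1 p.2 ω) :=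
    Finset.measurable_sum _ fun p _ => (measurable_llr _ _).comp (hX p.1 p.2)
  obtain ⟨A, hA⟩ := exists_measureReal_lt_neg_le (Pr 0) hS
    (show 0 < (1 - ε) / 2 by linarith [hε.2])
  refine lt_of_lt_of_le (mul_pos (Real.exp_pos _) ?_)
    (exp_neg_mul_le_optTypeIICentralized hac01 hac10 hX hlaw hindep hε.1.le t A)
  linarith [hε.2]

/-- The weak law of large numbers under hypothesis `0` for weighted sums of log-likelihood
ratios. -/
lemma tendsto_measureReal_weighted_sum_llr (hac01 : ∀ j, P 0 j ≪ P 1 j)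
    (hL2 : ∀ j, MemLp (llr (P 1 j) (P 0 j)) 2 (P 0 j))
    (hX : ∀ τ j, Measurable (X τ j)) (hlaw : ∀ θ τ j, (Pr θ).map (X τ j) = P θ j)
    (hindep : ∀ θ, iIndepFun (fun p : ℕ × Fin n => X p.1 p.2) (Pr θ))
    {a : ℕ → ℕ × Fin n → ℝ} {C : ℝ} (ha : ∀ t p, |a t p| ≤ C) {δ : ℝ} (hδ : 0 < δ) :
    Tendsto (fun t : ℕ => (Pr 0).real {ω | t * δ ≤ |∑ p ∈ Finset.range t ×ˢ Finset.univ,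
      a t p * llr (P 1 p.2) (P 0 p.2) (X p.1 p.2 ω) - ∑ p ∈ Finset.range t ×ˢ Finset.univ,
      a t p * -(InformationTheory.klDiv (P 0 p.2) (P 1 p.2)).toReal|}) atTop (𝓝 0) := by
  have hmp : ∀ p : ℕ × Fin n, MeasurePreserving (X p.1 p.2) (Pr 0) (P 0 p.2) :=
    fun p => ⟨hX _ _, hlaw _ _ _⟩
  have hmean : ∀ p : ℕ × Fin n, ∫ ω, llr (P 1 p.2) (P 0 p.2) (X p.1 p.2 ω) ∂(Pr 0) =
      -(InformationTheory.klDiv (P 0 p.2) (P 1 p.2)).toReal := fun p => by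
    rw [← integral_llr_eq_neg_toReal_klDiv (hac01 p.2), ← (hmp p).map_eq, integral_map
      (hX _ _).aemeasurable (measurable_llr _ _).aestronglyMeasurable]
  simp_rw [← hmean]
  refine tendsto_measureReal_weighted_sum (iIndepFun_llr hindep 0)
    (fun p => (hL2 p.2).comp_measurePreserving (hmp p))
    (V := ∑ j, Var[llr (P 1 j) (P 0 j); P 0 j]) (fun p => ?_) ha hδ
  rw [(hmp p).variance_fun_comp (measurable_llr _ _).aemeasurable]
  exact Finset.single_le_sum (f := fun j => Var[llr (P 1 j) (P 0 j); P 0 j])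
    (fun j _ => variance_nonneg _ _) (Finset.mem_univ p.2)

/-- Converse half of Stein's lemma: under hypothesis `0` the total log-likelihood ratio
concentrates at `-t * ∑ j, D_j`, which bounds the change of measure. -/
lemma eventually_exp_mul_le_optTypeIICentralized (hac01 : ∀ j, P 0 j ≪ P 1 j)
    (hac10 : ∀ j, P 1 j ≪ P 0 j) (hL2 : ∀ j, MemLp (llr (P 1 j) (P 0 j)) 2 (P 0 j))
    (hX : ∀ τ j, Measurable (X τ j)) (hlaw : ∀ θ τ j, (Pr θ).map (X τ j) = P θ j)
    (hindep : ∀ θ, iIndepFun (fun p : ℕ × Fin n => X p.1 p.2) (Pr θ)) {ε : ℝ}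
    (hε : ε ∈ Set.Ioo (0 : ℝ) 1) {δ : ℝ} (hδ : 0 < δ) :
    ∀ᶠ t : ℕ in atTop,
      Real.exp (-(t * (∑ j, (InformationTheory.klDiv (P 0 j) (P 1 j)).toReal + δ))) *
        ((1 - ε) / 2) ≤ optTypeIICentralized Pr X ε t := by
  have hlim := tendsto_measureReal_weighted_sum_llr hac01 hL2 hX hlaw hindep
    (a := fun _ _ => 1) (C := 1) (by simp) hδ
  filter_upwards [hlim.eventually (ge_mem_nhds (show 0 < (1 - ε) / 2 by linarith [hε.2]))]
    with t ht
  refine le_trans (mul_le_mul_of_nonneg_left ?_ (Real.exp_pos _).le)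
    (exp_neg_mul_le_optTypeIICentralized hac01 hac10 hX hlaw hindep hε.1.le t _)
  have hsub : (Pr 0).real {ω | ∑ p ∈ Finset.range t ×ˢ Finset.univ,
      llr (P 1 p.2) (P 0 p.2) (X p.1 p.2 ω) <
        -(t * (∑ j, (InformationTheory.klDiv (P 0 j) (P 1 j)).toReal + δ))} ≤ (1 - ε) / 2 := by
    refine le_trans (measureReal_mono fun ω hω => ?_) ht
    simp only [Set.mem_ofPred_eq, one_mul] at hω ⊢
    have hm : ∑ p ∈ Finset.range t ×ˢ (Finset.univ : Finset (Fin n)),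
        -(InformationTheory.klDiv (P 0 p.2) (P 1 p.2)).toReal =
        -(t * ∑ j, (InformationTheory.klDiv (P 0 j) (P 1 j)).toReal) := by
      refine (Finset.sum_product' (Finset.range t) Finset.univ
        fun _ j => -(InformationTheory.klDiv (P 0 j) (P 1 j)).toReal).trans ?_
      rw [Finset.sum_const, Finset.card_range, Finset.sum_neg_distrib, nsmul_eq_mul, mul_neg]
    rw [hm, le_abs]
    right
    linarith
  linarith

/-- Achievability for the log-belief test with threshold `-c t (∑ j, D_j - δ / 2)`. By convergence
of the powers of `W` to `π`, the weights `c / π j` make the log-belief behave like `c` times the total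
log-likelihood ratio: its mean under hypothesis `0` is `-c t ∑ j, D_j + o(t)`, and its cumulant
generating function under hypothesis `1` is `o(t)` at `-1 / c`. -/
lemma eventually_optTypeII_le_exp {W : Matrix (Fin n) (Fin n) ℝ}
    (hWstoch : W ∈ Matrix.rowStochastic ℝ (Fin n)) {π : Fin n → ℝ} (hπpos : ∀ j, 0 < π j)
    (hπlim : ∀ i j, Tendsto (fun k => (W ^ k) i j) atTop (𝓝 (π j)))
    (hac01 : ∀ j, P 0 j ≪ P 1 j)
    (hac10 : ∀ j, P 1 j ≪ P 0 j) (hmgf : ∀ j, ∀ s : ℝ, s ≤ 0 →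
      Integrable (fun x => Real.exp (s * llr (P 1 j) (P 0 j) x)) (P 1 j))
    (hX : ∀ τ j, Measurable (X τ j)) (hlaw : ∀ θ τ j, (Pr θ).map (X τ j) = P θ j)
    (hindep : ∀ θ, iIndepFun (fun p : ℕ × Fin n => X p.1 p.2) (Pr θ)) {c : ℝ} (hc : 0 < c) {ε : ℝ}
    (hε : ε ∈ Set.Ioo (0 : ℝ) 1) {δ : ℝ} (hδ : 0 < δ) (i : Fin n) :
    ∀ᶠ t : ℕ in atTop, optTypeII W P Pr X (fun j => c / π j) ε i t ≤
      Real.exp (-(t * (∑ j, (InformationTheory.klDiv (P 0 j) (P 1 j)).toReal - δ))) := by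
  set D : ℝ := ∑ j, (InformationTheory.klDiv (P 0 j) (P 1 j)).toReal with hD
  set a : ℕ → ℕ × Fin n → ℝ := fun t p => (W ^ (t - p.1)) i p.2 * (c / π p.2) with ha
  have hcπ : ∀ j, 0 < c / π j := fun j => div_pos hc (hπpos j)
  have hWpow : ∀ k, W ^ k ∈ Matrix.rowStochastic ℝ (Fin n) := pow_mem_rowStochastic hWstoch
  have ha0 : ∀ t p, 0 ≤ a t p := fun t p => mul_nonneg ((hWpow _).1 _ _) (hcπ _).le
  have haC : ∀ t p, |a t p| ≤ ∑ j, c / π j := fun t p => by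
    rw [abs_of_nonneg (ha0 t p)]
    refine (mul_le_of_le_one_left (hcπ _).le
      (Matrix.le_one_of_mem_rowStochastic (hWpow _))).trans ?_
    exact Finset.single_le_sum (f := fun j => c / π j) (fun j _ => (hcπ j).le)
      (Finset.mem_univ p.2)
  have hL2 := fun j => memLp_two_llr (hac01 j) (hac10 j) (hmgf j (-2) (by norm_num))
  have hδ' : 0 < c * δ / 4 := by positivity
  have hweak := tendsto_measureReal_weighted_sum_llr hac01 hL2 hX hlaw hindep haC hδ'
  have hmean : Tendsto (fun t : ℕ => (t : ℝ)⁻¹ * ∑ p ∈ Finset.range t ×ˢ Finset.univ,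
      a t p * -(InformationTheory.klDiv (P 0 p.2) (P 1 p.2)).toReal) atTop (𝓝 (-(c * D))) := by
    have h := tendsto_inv_mul_sum_range_product (F := fun k j => (W ^ k) i j * (c / π j) *
      -(InformationTheory.klDiv (P 0 j) (P 1 j)).toReal) fun j =>
        ((hπlim i j).mul_const (c / π j)).mul_const _
    have hl : ∑ j, π j * (c / π j) * -(InformationTheory.klDiv (P 0 j) (P 1 j)).toReal =
        -(c * D) := by
      rw [hD, Finset.mul_sum, ← Finset.sum_neg_distrib]
      refine Finset.sum_congr rfl fun j _ => ?_
      rw [mul_div_cancel₀ _ (hπpos j).ne', mul_neg]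
    rwa [hl] at h
  -- The weights are chosen so that the argument of each cumulant generating function tends to `-1`.
  have hcgf : Tendsto (fun t : ℕ => (t : ℝ)⁻¹ * ∑ p ∈ Finset.range t ×ˢ Finset.univ,
      cgf (llr (P 1 p.2) (P 0 p.2)) (P 1 p.2) (a t p * -c⁻¹)) atTop (𝓝 0) := by
    have h := tendsto_inv_mul_sum_range_product (F := fun k j =>
      cgf (llr (P 1 j) (P 0 j)) (P 1 j) ((W ^ k) i j * (c / π j) * -c⁻¹)) (l := fun _ => 0)
      fun j => by
        refine (tendsto_cgf_llr (hac01 j) (hac10 j) (hmgf j)).comp ?_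
        have hl : π j * (c / π j) * -c⁻¹ = -1 := by
          rw [mul_div_cancel₀ _ (hπpos j).ne', mul_neg, mul_inv_cancel₀ hc.ne']
        rw [← hl]
        exact ((hπlim i j).mul_const (c / π j)).mul_const _
    simpa using h
  filter_upwards [hweak.eventually (ge_mem_nhds hε.1),
    hmean.eventually (gt_mem_nhds (show -(c * D) < -(c * D) + c * δ / 4 by linarith)),
    hcgf.eventually (gt_mem_nhds (show 0 < δ / 2 by positivity)), eventually_gt_atTop 0]
    with t h1 h2 h3 ht
  have ht' : (0 : ℝ) < t := by exact_mod_cast ht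
  rw [inv_mul_lt_iff₀ ht'] at h2 h3
  set S : Ω → ℝ := fun ω => logBelief W P (fun j => c / π j) (fun τ j => X τ j ω) t i with hS
  set Y : ℕ × Fin n → Ω → ℝ := fun p ω => a t p * llr (P 1 p.2) (P 0 p.2) (X p.1 p.2 ω) with hY
  have hSY : S = ∑ p ∈ Finset.range t ×ˢ Finset.univ, Y p := by
    ext ω
    rw [Finset.sum_apply]
    exact logBelief_eq_sum _ _ _ _ _ _
  have hYm : ∀ p, Measurable (Y p) := fun p =>
    ((measurable_llr _ _).comp (hX p.1 p.2)).const_mul _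
  have hSm : Measurable S := by
    rw [hSY, Finset.sum_fn]
    exact Finset.measurable_sum _ fun p _ => hYm p
  -- Half of `δ` goes to the threshold: a quarter covers the `o(t)` error in the mean and a quarter
  -- the fluctuation around it. The other half covers the cumulant generating function.
  set γ : ℝ := -(c * t * (D - δ / 2)) with hγ
  have htypeI : typeIError Pr S 0 γ ≤ ε := by
    rw [typeIError, zero_mul, add_zero]
    refine le_trans (measureReal_mono fun ω hω => ?_) h1
    simp only [Set.mem_ofPred_eq, hSY, Finset.sum_apply] at hω ⊢
    rw [le_abs]
    left
    have : γ = t * (-(c * D) + c * δ / 4) + t * (c * δ / 4) := by rw [hγ]; ring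
    linarith
  have htypeII : typeIIError Pr S 0 γ ≤ (Pr 1).real {ω | S ω ≤ γ} := by
    rw [typeIIError, sub_zero, one_mul,
      ← measureReal_union _ (measurableSet_eq_fun hSm measurable_const)]
    · exact measureReal_mono fun ω hω => hω.elim (fun h : S ω < γ => h.le)
        fun h : S ω = γ => h.le
    · exact Set.disjoint_left.2 fun ω h h' => (ne_of_lt h) h'
  have hYindep : iIndepFun Y (Pr 1) :=
    (iIndepFun_llr (P := P) hindep 1).comp (fun p y => a t p * y)
      fun p => measurable_const_mul (a t p)
  have hYint : ∀ p, Integrable (fun ω => Real.exp (-c⁻¹ * Y p ω)) (Pr 1) := fun p => by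
    have hs : a t p * -c⁻¹ ≤ 0 := mul_nonpos_of_nonneg_of_nonpos (ha0 t p) (by simp [hc.le])
    refine (((⟨hX p.1 p.2, hlaw 1 p.1 p.2⟩ : MeasurePreserving _ _ _).integrable_comp
      (hmgf p.2 _ hs).aestronglyMeasurable).2 (hmgf p.2 _ hs)).congr (ae_of_all _ fun ω => ?_)
    simp only [Function.comp, hY]
    congr 1
    ring
  have hYcgf : ∀ p, cgf (Y p) (Pr 1) (-c⁻¹) =
      cgf (llr (P 1 p.2) (P 0 p.2)) (P 1 p.2) (a t p * -c⁻¹) := fun p => by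
    rw [cgf, cgf, hY, mgf_const_mul, ← hlaw 1 p.1 p.2, mgf_map (hX _ _).aemeasurable
      (((measurable_llr _ _).const_mul _).exp).aestronglyMeasurable]
    simp only [hlaw, Function.comp_def]
  have hchernoff : (Pr 1).real {ω | S ω ≤ γ} ≤
      Real.exp (-(-c⁻¹) * γ + cgf S (Pr 1) (-c⁻¹)) :=
    measure_le_le_exp_cgf γ (by simp [hc.le]) (by
      rw [hSY]
      exact hYindep.integrable_exp_mul_sum hYm fun p _ => hYint p)
  refine (optTypeII_le_typeIIError W _ i t (by simp) htypeI).trans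
    (htypeII.trans (hchernoff.trans (Real.exp_le_exp.2 ?_)))
  rw [hSY, hYindep.cgf_sum hYm fun p _ => hYint p]
  simp_rw [hYcgf]
  have : -(-c⁻¹) * γ = -(t * (D - δ / 2)) := by rw [hγ]; field_simp
  rw [this]
  linarith

end Bounds

/-! ### The error exponents -/

/-- A sequence trapped between exponentials of rate arbitrarily close to `D` has exponent `D`. -/
lemma tendsto_neg_inv_mul_log {β : ℕ → ℝ} {D K : ℝ} (hK : 0 < K)
    (hlow : ∀ δ > 0, ∀ᶠ t : ℕ in atTop, Real.exp (-(t * (D + δ))) * K ≤ β t)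
    (hup : ∀ δ > 0, ∀ᶠ t : ℕ in atTop, β t ≤ Real.exp (-(t * (D - δ)))) :
    Tendsto (fun t : ℕ => -(1 / (t : ℝ)) * Real.log (β t)) atTop (𝓝 D) := by
  rw [Metric.tendsto_nhds]
  intro e he
  have hKlim : Tendsto (fun t : ℕ => Real.log K * (t : ℝ)⁻¹) atTop (𝓝 0) := by
    simpa using (tendsto_inv_atTop_nhds_zero_nat (𝕜 := ℝ)).const_mul (Real.log K)
  filter_upwards [hlow (e / 3) (by positivity), hup (e / 3) (by positivity),
    eventually_gt_atTop 0, hKlim.eventually (lt_mem_nhds (show -(e / 3) < 0 by linarith))]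
    with t h1 h2 ht h3
  have ht' : (0 : ℝ) < t := by exact_mod_cast ht
  have hβ : 0 < β t := lt_of_lt_of_le (mul_pos (Real.exp_pos _) hK) h1
  have h1' := Real.log_le_log (mul_pos (Real.exp_pos _) hK) h1
  have h2' := Real.log_le_log hβ h2
  rw [Real.log_mul (Real.exp_pos _).ne' hK.ne', Real.log_exp] at h1'
  rw [Real.log_exp] at h2'
  have h4 : -(e / 3) * t < Real.log K := by
    have := mul_lt_mul_of_pos_right h3 ht'
    rwa [mul_assoc, inv_mul_cancel₀ ht'.ne', mul_one] at this
  have h5 : -(1 / (t : ℝ)) * Real.log (β t) = -Real.log (β t) / t := by ring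
  rw [Real.dist_eq, h5, abs_lt]
  constructor
  · rw [lt_sub_iff_add_lt, lt_div_iff₀ ht']
    nlinarith
  · rw [sub_lt_iff_lt_add, div_lt_iff₀ ht']
    nlinarith

end DecentralizedDetection

theorem mainTheorem1 {n : ℕ} {𝒳 : Fin n → Type*} [∀ j, MeasurableSpace (𝒳 j)]
    {Ω : Type*} [MeasurableSpace Ω]
    -- the weight matrix and its stationary distribution
    (W : Matrix (Fin n) (Fin n) ℝ) (hWstoch : W ∈ Matrix.rowStochastic ℝ (Fin n))
    (hWirr : W.IsIrreducible) (hWaper : DecentralizedDetection.IsAperiodic W)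
    (π : Fin n → ℝ) (hπ : DecentralizedDetection.IsStationary W π)
    -- the sample distributions of the nodes under the two hypotheses
    (P : Fin 2 → ∀ j, Measure (𝒳 j)) [∀ θ j, IsProbabilityMeasure (P θ j)]
    (hac01 : ∀ j, P 0 j ≪ P 1 j) (hac10 : ∀ j, P 1 j ≪ P 0 j)
    (hmgf : ∀ j, ∀ s : ℝ, s ≤ 0 →
      Integrable (fun x => Real.exp (s * llr (P 1 j) (P 0 j) x)) (P 1 j))
    -- the samples, independent over rounds and nodes, with law `P θ j` under hypothesis `θ`
    (Pr : Fin 2 → Measure Ω) [∀ θ, IsProbabilityMeasure (Pr θ)]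
    (X : ℕ → ∀ j, Ω → 𝒳 j) (hX : ∀ τ j, Measurable (X τ j))
    (hlaw : ∀ θ τ j, (Pr θ).map (X τ j) = P θ j)
    (hindep : ∀ θ, iIndepFun (fun p : ℕ × Fin n => X p.1 p.2) (Pr θ))
    -- the constant in the geometric weights, and the type-I level
    (c : ℝ) (hc : 0 < c) (ε : ℝ) (hε : ε ∈ Set.Ioo (0 : ℝ) 1) :
    (∀ j, InformationTheory.klDiv (P 0 j) (P 1 j) ≠ ⊤) ∧
    (∀ i t, 0 < DecentralizedDetection.optTypeII W P Pr X (fun j => c / π j) ε i t) ∧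
    (∀ i, Tendsto
      (fun t : ℕ => -(1 / (t : ℝ)) *
        Real.log (DecentralizedDetection.optTypeII W P Pr X (fun j => c / π j) ε i t))
      atTop (𝓝 (∑ j, (InformationTheory.klDiv (P 0 j) (P 1 j)).toReal))) ∧
    (∀ t, 0 < DecentralizedDetection.optTypeIICentralized Pr X ε t) ∧
    Tendsto
      (fun t : ℕ => -(1 / (t : ℝ)) *
        Real.log (DecentralizedDetection.optTypeIICentralized Pr X ε t))
      atTop (𝓝 (∑ j, (InformationTheory.klDiv (P 0 j) (P 1 j)).toReal)) := by
  have hprim := hWaper.isPrimitive hWirr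
  have hπpos := hπ.pos hprim
  have hπlim := hπ.tendsto_pow_apply hWstoch hprim
  have hL2 := fun j =>
    DecentralizedDetection.memLp_two_llr (hac01 j) (hac10 j) (hmgf j (-2) (by norm_num))
  have hpos := DecentralizedDetection.optTypeIICentralized_pos hac01 hac10 hX hlaw hindep hε
  have hcompare := fun i t => DecentralizedDetection.optTypeIICentralized_le_optTypeII
    (P := P) (Pr := Pr) hX W (fun j => c / π j) hε.1 i t
  have hlow := fun δ (hδ : 0 < δ) =>
    DecentralizedDetection.eventually_exp_mul_le_optTypeIICentralized
      hac01 hac10 hL2 hX hlaw hindep hε hδ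
  have hup := fun i δ (hδ : 0 < δ) => DecentralizedDetection.eventually_optTypeII_le_exp
    hWstoch hπpos hπlim hac01 hac10 hmgf hX hlaw hindep hc hε hδ i
  have hK : 0 < (1 - ε) / 2 := by linarith [hε.2]
  -- The stationary distribution has mass one, so there is at least one node.
  obtain ⟨i₀⟩ : Nonempty (Fin n) := by
    by_contra h
    rw [not_nonempty_iff] at h
    simpa using hπ.1.2
  refine ⟨fun j => DecentralizedDetection.klDiv_ne_top_of_memLp_llr (hac01 j) (hL2 j),
    fun i t => (hpos t).trans_le (hcompare i t), fun i => ?_, hpos, ?_⟩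
  · exact DecentralizedDetection.tendsto_neg_inv_mul_log hK
      (fun δ hδ => (hlow δ hδ).mono fun t h => h.trans (hcompare i t)) (hup i)
  · -- The centralized optimum inherits its upper bound from the log-belief test of any node.
    exact DecentralizedDetection.tendsto_neg_inv_mul_log hK hlow
      fun δ hδ => (hup i₀ δ hδ).mono fun t h => (hcompare i₀ t).trans h
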